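/- For $n\ge 0$, let a bracketed m-implication in $n$ variables be a formula obtained from $p_1\rightharpoonup p_2\rightharpoonup\cdots\rightharpoonup p_n$ (with $p_1,\dots,p_n$ distinct propositional variables in this order) by inserting brackets so that the result is well-formed (there is none for $n=0$, and for $n=1$ it is the variable $p_1$), where $\phi\rightharpoonup\psi$ means $\phi\to\neg\psi$, i.e. it is false exactly when $\phi$ and $\psi$ are both true. Consider the truth tables of all these formulae, each having one row for each of the $2^n$ valuations of $p_1,\dots,p_n$, and let $g_n$, $y_n$ and $d_n$ be, respectively, the total number of rows, the number of rows with the value "false", and the number of rows with the value "true", in all these tables together. Then $$d_0=0,\qquad d_n=g_n-y_n\quad\text{for all } n\ge 0,$$ and, as $n\to\infty$, $$d_n\sim\sqrt{\frac25}\;\frac{2^{3n-2}}{\sqrt{\pi n^3}}.$$ -/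

import Mathlib

/-- Formulae built from propositional variables (labelled by `α`) with the binary connective
`φ ⇀ ψ`, the modified implication. -/
inductive MFormula (α : Type) : Type
  | var (a : α) : MFormula α
  | mimp (φ ψ : MFormula α) : MFormula α

namespace MFormula

/-- The truth value of a formula under a valuation: `φ ⇀ ψ` means `φ → ¬ψ`, so it is false exactly
when `φ` and `ψ` are both true. -/
def eval {α : Type} (ν : α → Bool) : MFormula α → Bool
  | var a => ν a
  | mimp φ ψ => !(eval ν φ && eval ν ψ)

/-- The occurrences of variables in a formula, read from left to right. -/
def vars {α : Type} : MFormula α → List α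
  | var a => [a]
  | mimp φ ψ => vars φ ++ vars ψ

end MFormula

/-- The bracketed m-implications in `n` distinct variables: the formulae obtained from
`p₁ ⇀ p₂ ⇀ ⋯ ⇀ pₙ` by inserting brackets, i.e. those whose variables, read from left to right,
are `p₁, …, pₙ`, each occurring once. There are none for `n = 0`. -/
def bracketedFormulae (n : ℕ) : Set (MFormula (Fin n)) :=
  {φ | φ.vars = List.finRange n}

/-- The rows of all the truth tables of bracketed m-implications in `n` variables: a row is given by
the formula whose table it belongs to and a valuation of the `n` variables. -/
def tableRows (n : ℕ) : Set (MFormula (Fin n) × (Fin n → Bool)) :=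
  {r | r.1 ∈ bracketedFormulae n}

/-- `gₙ`, the total number of rows. -/
noncomputable def numRows (n : ℕ) : ℕ := (tableRows n).ncard

/-- `yₙ`, the number of rows with the value "false". -/
noncomputable def numFalseRows (n : ℕ) : ℕ :=
  {r ∈ tableRows n | r.1.eval r.2 = false}.ncard

/-- `dₙ`, the number of rows with the value "true". -/
noncomputable def numTrueRows (n : ℕ) : ℕ :=
  {r ∈ tableRows n | r.1.eval r.2 = true}.ncard

theorem MFormula.vars_length_pos {α : Type} (φ : MFormula α) : 0 < φ.vars.length := by
  induction φ with
  | var a => simp [MFormula.vars]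
  | mimp φ ψ h1 h2 => simp only [MFormula.vars, List.length_append]; omega

theorem MFormula.finite_vars_eq {α : Type} [Finite α] (n : ℕ) :
    ∀ l : List α, l.length = n → {φ : MFormula α | φ.vars = l}.Finite := by
  induction n using Nat.strong_induction_on with
  | _ n ih =>
    intro l hl
    have hfin : (⋃ i ∈ {i : ℕ | 0 < i ∧ i < n},
        Set.image2 MFormula.mimp {φ : MFormula α | φ.vars = l.take i}
          {φ : MFormula α | φ.vars = l.drop i}).Finite := by
      refine Set.Finite.biUnion ((Set.finite_lt_nat n).subset fun i hi => hi.2) ?_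
      rintro i ⟨h0, h1⟩
      refine Set.Finite.image2 _ (ih i h1 _ ?_) (ih (n - i) (by omega) _ ?_)
      · simp only [List.length_take]; omega
      · simp only [List.length_drop]; omega
    refine ((Set.finite_range (MFormula.var : α → MFormula α)).union hfin).subset ?_
    intro φ hφ
    cases φ with
    | var a => exact Or.inl ⟨a, rfl⟩
    | mimp φ ψ =>
      right
      have h : φ.vars ++ ψ.vars = l := hφ
      have h1 := φ.vars_length_pos
      have h2 := ψ.vars_length_pos
      have h3 : φ.vars.length + ψ.vars.length = n := by
        rw [← hl, ← h, List.length_append]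
      refine Set.mem_biUnion (x := φ.vars.length) ⟨h1, by omega⟩ ?_
      refine ⟨φ, ?_, ψ, ?_, rfl⟩
      · simp [← h]
      · simp [← h]

/-- There are finitely many rows, so the cardinalities above are genuine counts. -/
theorem tableRows_finite (n : ℕ) : (tableRows n).Finite := by
  have h : (bracketedFormulae n).Finite := MFormula.finite_vars_eq _ _ rfl
  refine (h.prod (Set.finite_univ (α := Fin n → Bool))).subset ?_
  intro r hr
  exact ⟨hr, Set.mem_univ _⟩

/-! A row amounts to a binary tree with Boolean leaves, so `gₙ = 2 ^ n * catalan (n - 1)`, and for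
`n ≠ 1` a false row is a pair of true rows: `y` is the convolution `d * d`. Put `aₙ = dₙ / 8 ^ n`
and `hₙ = gₙ / 8 ^ n`. Then `a + a * a = h` except at `n = 1`. Since `∑ h = 1 / 2`, summation with
the correction `1 / 8` at `n = 1` gives `(1 + 2δ) ^ 2 = 5 / 2` for `δ = ∑ a`.

No singularity analysis is needed. As `h` decays polynomially, `a * a` at `n` is governed by terms
with one small index, so it behaves like `2δ aₙ`, whence `aₙ / hₙ → 1 / (1 + 2δ) = √(2 / 5)`. The
inequality `2δ < 1` makes this a contraction (`tendsto_div_of_add_convolution_eq`). Wallis' product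
gives `hₙ √(π n ^ 3) → 1 / 4`. -/

/-! ### Rows as binary trees with Boolean leaves -/

namespace MFormula

/-- Replace every variable by its image under `f`. -/
def relabel {α β : Type} (f : α → β) : MFormula α → MFormula β
  | var a => var (f a)
  | mimp φ ψ => mimp (relabel f φ) (relabel f ψ)

theorem vars_relabel {α β : Type} (f : α → β) (φ : MFormula α) :
    (φ.relabel f).vars = φ.vars.map f := by
  induction φ with
  | var a => rfl
  | mimp φ ψ h1 h2 => simp [relabel, vars, h1, h2]

theorem eval_relabel {α : Type} (ν : α → Bool) (φ : MFormula α) :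
    (φ.relabel ν).eval id = φ.eval ν := by
  induction φ with
  | var a => rfl
  | mimp φ ψ h1 h2 => simp [relabel, eval, h1, h2]

/-- Equal relabellings force equal tree shapes, and a tree is determined by its shape and its list
of leaves. -/
theorem eq_of_relabel_eq {α β γ : Type} {f : α → γ} {g : β → γ} (k : α → β) :
    ∀ {φ : MFormula α} {ψ : MFormula β}, φ.relabel f = ψ.relabel g →
      φ.vars.map k = ψ.vars → φ.relabel k = ψ := by
  intro φ
  induction φ with
  | var a =>
    intro ψ h hv
    cases ψ with
    | var b => simpa [relabel, vars] using hv
    | mimp => simp [relabel] at h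
  | mimp φ₁ φ₂ ih₁ ih₂ =>
    intro ψ h hv
    cases ψ with
    | var b => simp [relabel] at h
    | mimp ψ₁ ψ₂ =>
      simp only [relabel, mimp.injEq] at h
      simp only [vars, List.map_append] at hv
      have hl := congrArg (fun χ => χ.vars.length) h.1
      simp only [vars_relabel, List.length_map] at hl
      obtain ⟨h1, h2⟩ := List.append_inj hv (by simpa using hl)
      rw [relabel, ih₁ h.1 h1, ih₂ h.2 h2]

theorem relabel_id {α : Type} (φ : MFormula α) : φ.relabel id = φ := by
  induction φ with
  | var a => rfl
  | mimp φ ψ h1 h2 => rw [relabel, h1, h2]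

/-- Relabelling into `Unit` keeps only the shape: any list of the right length can be hung on the
shape of `ψ`. -/
theorem exists_relabel_eq {α β : Type} (ψ : MFormula β) :
    ∀ l : List α, l.length = ψ.vars.length →
      ∃ φ : MFormula α, φ.vars = l ∧
        φ.relabel (fun _ => ()) = ψ.relabel (fun _ => ()) := by
  induction ψ with
  | var b =>
    intro l hl
    obtain ⟨a, rfl⟩ := List.length_eq_one_iff.mp hl
    exact ⟨var a, rfl, rfl⟩
  | mimp ψ₁ ψ₂ ih₁ ih₂ =>
    intro l hl
    simp only [vars, List.length_append] at hl
    obtain ⟨φ₁, h1, e1⟩ := ih₁ (l.take ψ₁.vars.length) (by simp; omega)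
    obtain ⟨φ₂, h2, e2⟩ := ih₂ (l.drop ψ₁.vars.length) (by simp; omega)
    exact ⟨mimp φ₁ φ₂, by simp [vars, h1, h2], by simp [relabel, e1, e2]⟩

/-- Formulae with `n` leaves, each leaf carrying a truth value. -/
def valued (n : ℕ) : Set (MFormula Bool) := {φ | φ.vars.length = n}

theorem finite_valued (n : ℕ) : (valued n).Finite := by
  have h : (⋃ l ∈ {l : List Bool | l.length = n},
      {φ : MFormula Bool | φ.vars = l}).Finite :=
    (List.finite_length_eq Bool n).biUnion fun l hl => finite_vars_eq n l hl
  refine h.subset fun φ hφ => ?_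
  exact Set.mem_biUnion (x := φ.vars) hφ rfl

theorem relabel_injOn_tableRows (n : ℕ) :
    Set.InjOn (fun r : MFormula (Fin n) × (Fin n → Bool) => r.1.relabel r.2)
      (tableRows n) := by
  rintro ⟨φ, ν⟩ hφ ⟨ψ, μ⟩ hψ h
  have hφ' : φ.vars = List.finRange n := hφ
  have hψ' : ψ.vars = List.finRange n := hψ
  have h' : φ.relabel ν = ψ.relabel μ := h
  have h1 : φ = ψ := by
    rw [← eq_of_relabel_eq id h' (by simp [hφ', hψ']), relabel_id]
  have h2 : ν = μ := by
    have := congrArg vars h'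
    rw [vars_relabel, vars_relabel, hφ', hψ', List.map_inj_left] at this
    exact funext fun i => this i (List.mem_finRange i)
  rw [h1, h2]

theorem relabel_image_tableRows (n : ℕ) :
    (fun r : MFormula (Fin n) × (Fin n → Bool) => r.1.relabel r.2) '' tableRows n
      = valued n := by
  ext ψ
  constructor
  · rintro ⟨⟨φ, ν⟩, hφ, rfl⟩
    have hφ' : φ.vars = List.finRange n := hφ
    simp [valued, vars_relabel, hφ']
  · intro hψ
    have hψ' : ψ.vars.length = n := hψ
    obtain ⟨φ, hv, he⟩ := exists_relabel_eq ψ (List.finRange n) (by simp [hψ'])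
    refine ⟨⟨φ, fun i => ψ.vars.get (i.cast hψ'.symm)⟩, hv, ?_⟩
    refine eq_of_relabel_eq _ he ?_
    rw [hv]
    apply List.ext_getElem
    · simp [hψ']
    · intro i h1 h2
      simp

theorem ncard_rows (n : ℕ) (P : Bool → Prop) :
    {r ∈ tableRows n | P (r.1.eval r.2)}.ncard
      = {φ ∈ valued n | P (φ.eval id)}.ncard := by
  rw [← ((relabel_injOn_tableRows n).mono (Set.sep_subset _ _)).ncard_image]
  congr 1
  ext ψ
  constructor
  · rintro ⟨r, ⟨hr, hP⟩, rfl⟩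
    refine ⟨relabel_image_tableRows n ▸ Set.mem_image_of_mem _ hr, ?_⟩
    simpa [eval_relabel] using hP
  · rintro ⟨hψ, hP⟩
    rw [← relabel_image_tableRows n] at hψ
    obtain ⟨r, hr, rfl⟩ := hψ
    exact ⟨r, ⟨hr, by simpa [eval_relabel] using hP⟩, rfl⟩

/-- Used with `S` everything, for all rows, and with `S` the true trees, for the false rows. -/
theorem ncard_mimp (S : Set (MFormula Bool)) (n : ℕ) :
    {χ | ∃ φ ∈ S, ∃ ψ ∈ S, χ = mimp φ ψ ∧ χ ∈ valued n}.ncard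
      = ∑ ij ∈ Finset.HasAntidiagonal.antidiagonal n, (S ∩ valued ij.1).ncard * (S ∩ valued ij.2).ncard := by
  classical
  have hf : ∀ i, (S ∩ valued i).Finite := fun i => (finite_valued i).inter_of_right S
  have hu : {χ | ∃ φ ∈ S, ∃ ψ ∈ S, χ = mimp φ ψ ∧ χ ∈ valued n}
      = ((Finset.HasAntidiagonal.antidiagonal n).biUnion fun ij =>
          ((hf ij.1).toFinset ×ˢ (hf ij.2).toFinset).image fun p => mimp p.1 p.2 :
          Finset (MFormula Bool)) := by
    ext χ
    simp only [Set.mem_ofPred_eq, Finset.coe_biUnion, Set.mem_iUnion, Finset.mem_coe,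
      Finset.mem_image, Finset.mem_product, Set.Finite.mem_toFinset, Prod.exists,
      Finset.HasAntidiagonal.mem_antidiagonal, exists_prop]
    constructor
    · rintro ⟨φ, hφ, ψ, hψ, rfl, hn⟩
      refine ⟨φ.vars.length, ψ.vars.length, ?_, φ, ψ, ⟨⟨hφ, rfl⟩, hψ, rfl⟩, rfl⟩
      simpa [valued, vars] using hn
    · rintro ⟨i, j, hij, φ, ψ, ⟨⟨hφ, hi⟩, hψ, hj⟩, rfl⟩
      refine ⟨φ, hφ, ψ, hψ, rfl, ?_⟩
      simp only [valued, Set.mem_ofPred_eq] at hi hj ⊢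
      simp [vars, hi, hj, hij]
  rw [hu, Set.ncard_coe_finset, Finset.card_biUnion]
  · refine Finset.sum_congr rfl fun ij _ => ?_
    rw [Finset.card_image_of_injective, Finset.card_product,
      ← Set.ncard_eq_toFinset_card _ (hf _), ← Set.ncard_eq_toFinset_card _ (hf _)]
    rintro ⟨a, b⟩ ⟨c, d⟩ h
    simpa using h
  · rintro ⟨i, j⟩ _ ⟨i', j'⟩ _ hne
    rw [Function.onFun, Finset.disjoint_left]
    intro χ h1 h2
    simp only [Finset.mem_image, Finset.mem_product, Set.Finite.mem_toFinset,
      Prod.exists] at h1 h2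
    obtain ⟨φ, ψ, ⟨⟨_, h1⟩, _, h2⟩, rfl⟩ := h1
    obtain ⟨φ', ψ', ⟨⟨_, h3⟩, _, h4⟩, he⟩ := h2
    obtain ⟨rfl, rfl⟩ := mimp.inj he
    exact hne (Prod.ext (h1.symm.trans h3) (h2.symm.trans h4))

theorem exists_mimp_of_mem_valued {n : ℕ} (hn : n ≠ 1) {χ : MFormula Bool}
    (hχ : χ ∈ valued n) : ∃ φ ψ, χ = mimp φ ψ := by
  cases χ with
  | var a => exact absurd hχ.symm hn
  | mimp φ ψ => exact ⟨φ, ψ, rfl⟩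

theorem exists_var_of_mem_valued_one {χ : MFormula Bool} (hχ : χ ∈ valued 1) :
    ∃ a, χ = var a := by
  cases χ with
  | var a => exact ⟨a, rfl⟩
  | mimp φ ψ =>
    have h1 := φ.vars_length_pos
    have h2 := ψ.vars_length_pos
    simp only [valued, vars, Set.mem_ofPred_eq, List.length_append] at hχ
    omega

end MFormula

/-! ### Recurrences for the row counts -/

open MFormula

theorem numRows_eq_ncard_valued (n : ℕ) : numRows n = (valued n).ncard := by
  simpa [numRows] using ncard_rows n fun _ => True

theorem numTrueRows_eq_ncard_valued (n : ℕ) :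
    numTrueRows n = {φ ∈ valued n | φ.eval id = true}.ncard :=
  ncard_rows n fun b => b = true

theorem numFalseRows_eq_ncard_valued (n : ℕ) :
    numFalseRows n = {φ ∈ valued n | φ.eval id = false}.ncard :=
  ncard_rows n fun b => b = false

theorem numTrueRows_add_numFalseRows (n : ℕ) :
    numTrueRows n + numFalseRows n = numRows n := by
  unfold numTrueRows numFalseRows numRows
  have hf (b : Bool) : {r ∈ tableRows n | r.1.eval r.2 = b}.Finite :=
    (tableRows_finite n).subset (Set.sep_subset _ _)
  rw [← Set.ncard_union_eq _ (hf true) (hf false)]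
  · congr 1
    ext r
    simp only [Set.mem_union, Set.mem_ofPred_eq]
    cases r.1.eval r.2 <;> simp
  · rw [Set.disjoint_left]
    rintro r ⟨_, h1⟩ ⟨_, h2⟩
    simp [h1] at h2

theorem numRows_zero : numRows 0 = 0 := by
  rw [numRows_eq_ncard_valued, Set.ncard_eq_zero (finite_valued 0), Set.eq_empty_iff_forall_notMem]
  intro φ hφ
  exact φ.vars_length_pos.ne' hφ

theorem numRows_one : numRows 1 = 2 := by
  rw [numRows_eq_ncard_valued, Set.ncard_eq_two]
  refine ⟨var true, var false, by simp, ?_⟩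
  ext φ
  constructor
  · intro h
    obtain ⟨_ | _, rfl⟩ := exists_var_of_mem_valued_one h <;> simp
  · rintro (rfl | rfl) <;> rfl

theorem numTrueRows_one : numTrueRows 1 = 1 := by
  rw [numTrueRows_eq_ncard_valued, Set.ncard_eq_one]
  refine ⟨var true, ?_⟩
  ext φ
  constructor
  · rintro ⟨h, h'⟩
    obtain ⟨_ | _, rfl⟩ := exists_var_of_mem_valued_one h
    · simp [eval] at h'
    · rfl
  · rintro rfl
    exact ⟨rfl, rfl⟩

theorem numRows_eq_sum {n : ℕ} (hn : n ≠ 1) :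
    numRows n = ∑ ij ∈ Finset.HasAntidiagonal.antidiagonal n, numRows ij.1 * numRows ij.2 := by
  have h := ncard_mimp Set.univ n
  simp only [Set.univ_inter, ← numRows_eq_ncard_valued] at h
  rw [← h, numRows_eq_ncard_valued]
  congr 1
  ext χ
  constructor
  · intro hχ
    obtain ⟨φ, ψ, rfl⟩ := exists_mimp_of_mem_valued hn hχ
    exact ⟨φ, trivial, ψ, trivial, rfl, hχ⟩
  · rintro ⟨_, _, _, _, _, hχ⟩
    exact hχ

theorem numFalseRows_eq_sum {n : ℕ} (hn : n ≠ 1) :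
    numFalseRows n = ∑ ij ∈ Finset.HasAntidiagonal.antidiagonal n, numTrueRows ij.1 * numTrueRows ij.2 := by
  have h := ncard_mimp {φ | φ.eval id = true} n
  have e : ∀ i, {φ : MFormula Bool | φ.eval id = true} ∩ valued i
      = {φ ∈ valued i | φ.eval id = true} := fun i => Set.inter_comm _ _
  simp only [e, ← numTrueRows_eq_ncard_valued] at h
  rw [← h, numFalseRows_eq_ncard_valued]
  congr 1
  ext χ
  constructor
  · rintro ⟨hχ, hf⟩
    obtain ⟨φ, ψ, rfl⟩ := exists_mimp_of_mem_valued hn hχ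
    simp only [eval, Bool.not_eq_false', Bool.and_eq_true] at hf
    exact ⟨φ, hf.1, ψ, hf.2, rfl, hχ⟩
  · rintro ⟨φ, hφ, ψ, hψ, rfl, hχ⟩
    refine ⟨hχ, ?_⟩
    simp only [Set.mem_ofPred_eq] at hφ hψ
    simp [eval, hφ, hψ]

theorem numRows_succ_eq_catalan (n : ℕ) : numRows (n + 1) = 2 ^ (n + 1) * catalan n := by
  induction n using Nat.strong_induction_on with
  | _ n ih =>
    rcases n with _ | n
    · simp [numRows_one]
    -- Both end terms contain `numRows 0 = 0`; what remains is the Catalan convolution.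
    · rw [numRows_eq_sum (by omega), Finset.Nat.sum_antidiagonal_succ,
        Finset.Nat.sum_antidiagonal_succ', numRows_zero, catalan_succ', Finset.mul_sum]
      simp only [zero_mul, mul_zero, zero_add]
      refine Finset.sum_congr rfl fun ij hij => ?_
      rw [Finset.HasAntidiagonal.mem_antidiagonal] at hij
      rw [ih _ (by omega), ih _ (by omega), ← hij]
      ring

/-! ### Ratio limit for a convolution equation -/

open Filter Topology

/-- Weights that gather a symmetric sum over `0, …, n` onto its lower half. -/
def halfWeight (n i : ℕ) : ℝ := if 2 * i < n then 2 else if 2 * i = n then 1 else 0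

theorem halfWeight_nonneg (n i : ℕ) : 0 ≤ halfWeight n i := by
  unfold halfWeight; split_ifs <;> norm_num

theorem halfWeight_le_two (n i : ℕ) : halfWeight n i ≤ 2 := by
  unfold halfWeight; split_ifs <;> norm_num

theorem halfWeight_eq_zero {n i : ℕ} (h : n < 2 * i) : halfWeight n i = 0 := by
  unfold halfWeight
  rw [if_neg (by omega), if_neg (by omega)]

theorem halfWeight_eq_two {n i : ℕ} (h : 2 * i < n) : halfWeight n i = 2 := if_pos h

theorem halfWeight_add_halfWeight_sub {n i : ℕ} (h : i ≤ n) :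
    halfWeight n i + halfWeight n (n - i) = 2 := by
  unfold halfWeight
  rcases lt_trichotomy (2 * i) n with h1 | h1 | h1
  · rw [if_pos h1, if_neg (by omega), if_neg (by omega)]; norm_num
  · rw [if_neg (by omega), if_pos h1, if_neg (by omega), if_pos (by omega)]; norm_num
  · rw [if_neg (by omega), if_neg (by omega), if_pos (by omega)]; norm_num

/-- On the lower half `n ≤ 2 * (n - i)`, so bounded doubling controls `h (n - i) / h n` uniformly in
`i`. -/
theorem sum_antidiagonal_eq_sum_halfWeight (a : ℕ → ℝ) (n : ℕ) :
    ∑ ij ∈ Finset.HasAntidiagonal.antidiagonal n, a ij.1 * a ij.2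
      = ∑ i ∈ Finset.range (n + 1), halfWeight n i * (a i * a (n - i)) := by
  rw [Finset.Nat.sum_antidiagonal_eq_sum_range_succ (fun i j => a i * a j)]
  have h1 := Finset.sum_range_reflect (fun i => halfWeight n i * (a i * a (n - i))) (n + 1)
  have h2 : ∑ i ∈ Finset.range (n + 1), halfWeight n (n - i) * (a i * a (n - i))
      = ∑ i ∈ Finset.range (n + 1), halfWeight n i * (a i * a (n - i)) := by
    rw [← h1]
    refine Finset.sum_congr rfl fun i hi => ?_
    have hi' : i ≤ n := by simpa [Nat.lt_succ_iff] using hi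
    have e1 : n + 1 - 1 - i = n - i := by omega
    have e2 : n - (n - i) = i := by omega
    rw [e1, e2]; ring
  have h3 : ∑ i ∈ Finset.range (n + 1), 2 * (a i * a (n - i))
      = ∑ i ∈ Finset.range (n + 1), halfWeight n i * (a i * a (n - i))
        + ∑ i ∈ Finset.range (n + 1), halfWeight n (n - i) * (a i * a (n - i)) := by
    rw [← Finset.sum_add_distrib]
    refine Finset.sum_congr rfl fun i hi => ?_
    rw [← add_mul, halfWeight_add_halfWeight_sub (by simpa [Nat.lt_succ_iff] using hi)]
  rw [h2, ← Finset.mul_sum] at h3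
  linarith

/-- If `e` is bounded and `e ≤ B` eventually implies `e ≤ q * B + ε` eventually, for some `q < 1`,
then `e` tends to `0`. -/
theorem tendsto_zero_of_contraction {e : ℕ → ℝ} (he : ∀ n, 0 ≤ e n) {B₀ : ℝ}
    (hB₀ : ∀ᶠ n in atTop, e n ≤ B₀) {q : ℝ} (hq1 : q < 1)
    (h : ∀ B, (∀ᶠ n in atTop, e n ≤ B) → ∀ ε > 0, ∀ᶠ n in atTop, e n ≤ q * B + ε) :
    Tendsto e atTop (𝓝 0) := by
  set S : Set ℝ := {B | ∀ᶠ n in atTop, e n ≤ B}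
  have hS0 : ∀ B ∈ S, 0 ≤ B := fun B hB => by
    obtain ⟨n, hn⟩ := Filter.Eventually.exists hB
    exact (he n).trans hn
  have hbdd : BddBelow S := ⟨0, hS0⟩
  have hne : S.Nonempty := ⟨B₀, hB₀⟩
  have hI0 : 0 ≤ sInf S := le_csInf hne hS0
  have hI : sInf S ≤ 0 := by
    by_contra! hpos
    have hgap : 0 < (1 - q) * sInf S := mul_pos (by linarith) hpos
    -- `B` is so close to the infimum that `q * B + ε` falls below it; `|q| + 1` is positive
    -- whatever the sign of `q`.
    obtain ⟨B, hB, hlt⟩ := exists_lt_of_csInf_lt hne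
      (show sInf S < sInf S + (1 - q) * sInf S / (4 * (|q| + 1)) by
        have : 0 < |q| + 1 := by positivity
        have : 0 < (1 - q) * sInf S / (4 * (|q| + 1)) := by positivity
        linarith)
    have hle : sInf S ≤ B := csInf_le hbdd hB
    have h1 : sInf S ≤ q * B + (1 - q) * sInf S / 4 :=
      csInf_le hbdd (h B hB _ (by linarith))
    have h2 : q * (B - sInf S) ≤ (1 - q) * sInf S / 4 := by
      calc q * (B - sInf S) ≤ (|q| + 1) * (B - sInf S) :=
            mul_le_mul_of_nonneg_right (by linarith [le_abs_self q]) (by linarith)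
        _ ≤ (|q| + 1) * ((1 - q) * sInf S / (4 * (|q| + 1))) :=
            mul_le_mul_of_nonneg_left (by linarith) (by positivity)
        _ = (1 - q) * sInf S / 4 := by
            have : |q| + 1 ≠ 0 := by positivity
            field_simp
    linarith
  rw [Metric.tendsto_atTop']
  intro ε hε
  obtain ⟨B, hB, hlt⟩ := exists_lt_of_csInf_lt hne (show sInf S < ε by linarith)
  obtain ⟨N, hN⟩ := eventually_atTop.mp hB
  refine ⟨N, fun n hn => ?_⟩
  rw [Real.dist_eq, sub_zero, abs_of_nonneg (he n)]
  exact (hN n hn.le).trans_lt hlt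

/-- If `a + a * a = h` (with `*` the convolution) and `h` is a subexponential sequence of bounded
doubling, then `a n / h n` tends to `1 / (1 + 2 ∑ a)`, provided `2 ∑ a < 1`. -/
theorem tendsto_div_of_add_convolution_eq {a h : ℕ → ℝ} {C : ℝ} (ha : ∀ n, 0 ≤ a n)
    (hle : ∀ n, a n ≤ h n) (hpos : ∀ n, 1 ≤ n → 0 < h n)
    (hC : ∀ m n, 1 ≤ m → m ≤ n → n ≤ 2 * m → h m ≤ C * h n)
    (hlim : ∀ i, Tendsto (fun n => h (n - i) / h n) atTop (𝓝 1))
    (hs : Summable a) (hq : 2 * ∑' i, a i < 1)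
    (hrec : ∀ᶠ n in atTop, a n + ∑ ij ∈ Finset.HasAntidiagonal.antidiagonal n, a ij.1 * a ij.2 = h n) :
    Tendsto (fun n => a n / h n) atTop (𝓝 (1 / (1 + 2 * ∑' i, a i))) := by
  set δ := ∑' i, a i with hδ
  have hδ0 : 0 ≤ δ := tsum_nonneg ha
  set L := 1 / (1 + 2 * δ) with hL
  have hL0 : 0 < L := by positivity
  have hL1 : L ≤ 1 := by rw [hL, div_le_one (by positivity)]; linarith
  have hLeq : L * (1 + 2 * δ) = 1 := by rw [hL]; field_simp
  set p : ℕ → ℕ → ℝ := fun n i => halfWeight n i * (a i * (h (n - i) / h n)) with hp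
  have hh : ∀ n, 0 ≤ h n := fun n => (ha n).trans (hle n)
  have hp0 : ∀ n i, 0 ≤ p n i := fun n i =>
    mul_nonneg (halfWeight_nonneg n i) (mul_nonneg (ha i) (div_nonneg (hh _) (hh _)))
  have hC0 : 0 ≤ C := by
    have h1 := hC 1 1 le_rfl le_rfl (by norm_num)
    have h2 := hpos 1 le_rfl
    by_contra! hneg
    nlinarith
  -- Dominated convergence: for fixed `i` the weight is eventually `2` and the ratio tends to `1`.
  have hptend : Tendsto (fun n => ∑' i, p n i) atTop (𝓝 (2 * δ)) := by
    rw [hδ, ← tsum_mul_left]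
    refine tendsto_tsum_of_dominated_convergence (bound := fun i => 2 * (C * a i))
      ((hs.mul_left C).mul_left 2) (fun i => ?_) ?_
    · have h1 : Tendsto (fun n => 2 * (a i * (h (n - i) / h n))) atTop
          (𝓝 (2 * (a i * 1))) := ((hlim i).const_mul _).const_mul _
      rw [mul_one] at h1
      refine h1.congr' ?_
      filter_upwards [eventually_gt_atTop (2 * i)] with n hn
      rw [hp]; simp only [halfWeight_eq_two hn]
    · filter_upwards [eventually_ge_atTop 1] with n hn i
      rw [Real.norm_of_nonneg (hp0 n i)]
      rcases lt_or_ge n (2 * i) with hi | hi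
      · simp only [hp, halfWeight_eq_zero hi, zero_mul]
        have := ha i
        positivity
      · have h1 : h (n - i) / h n ≤ C := by
          rw [div_le_iff₀ (hpos n hn)]
          exact hC _ _ (by omega) (by omega) (by omega)
        calc p n i ≤ 2 * (a i * (h (n - i) / h n)) :=
              mul_le_mul_of_nonneg_right (halfWeight_le_two n i)
                (mul_nonneg (ha i) (div_nonneg (hh _) (hh _)))
          _ ≤ 2 * (a i * C) := by gcongr; exact ha i
          _ = 2 * (C * a i) := by ring
  have hpsum : ∀ n, ∑' i, p n i = ∑ i ∈ Finset.range (n + 1), p n i := fun n =>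
    tsum_eq_sum fun i hi => by
      have : n + 1 ≤ i := by simpa using hi
      simp only [hp, halfWeight_eq_zero (show n < 2 * i by omega), zero_mul]
  -- The recursion divided by `h n`, centred at `L`: the error at `n` is a vanishing term minus a
  -- weighted sum of errors at `n - i`, with total weight tending to `2 * δ`.
  have hratio : ∀ᶠ n in atTop, a n / h n - L
      = (1 - L * (1 + ∑' i, p n i))
        - ∑ i ∈ Finset.range (n + 1), p n i * (a (n - i) / h (n - i) - L) := by
    filter_upwards [hrec, eventually_ge_atTop 1] with n hn hn1
    have hne := (hpos n hn1).ne'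
    rw [sum_antidiagonal_eq_sum_halfWeight] at hn
    have h1 : ∑ i ∈ Finset.range (n + 1), p n i * (a (n - i) / h (n - i))
        = (∑ i ∈ Finset.range (n + 1), halfWeight n i * (a i * a (n - i))) / h n := by
      rw [Finset.sum_div]
      refine Finset.sum_congr rfl fun i _ => ?_
      rcases lt_or_ge n (2 * i) with hi | hi
      · simp [hp, halfWeight_eq_zero hi]
      · have := (hpos (n - i) (by omega)).ne'
        simp only [hp]
        field_simp
    have h2 : a n / h n = 1 - ∑ i ∈ Finset.range (n + 1), p n i * (a (n - i) / h (n - i)) := by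
      rw [h1, eq_sub_iff_add_eq, ← add_div, hn, div_self hne]
    simp only [mul_sub, Finset.sum_sub_distrib, ← Finset.sum_mul]
    rw [hpsum, h2]
    ring
  have hrem : Tendsto (fun n => |1 - L * (1 + ∑' i, p n i)|) atTop (𝓝 0) := by
    have h1 : Tendsto (fun n => |1 - L * (1 + ∑' i, p n i)|) atTop
        (𝓝 |1 - L * (1 + 2 * δ)|) :=
      ((((hptend.const_add 1).const_mul L).const_sub 1)).abs
    rwa [hLeq, sub_self, abs_zero] at h1
  have hbound : ∀ n, |a n / h n - L| ≤ 1 := fun n => by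
    have h1 : a n / h n ≤ 1 := div_le_one_of_le₀ (hle n) (hh n)
    have h2 : 0 ≤ a n / h n := div_nonneg (ha n) (hh n)
    rw [abs_le]; constructor <;> linarith
  have key : Tendsto (fun n => |a n / h n - L|) atTop (𝓝 0) := by
    refine tendsto_zero_of_contraction (fun n => abs_nonneg _)
      (Eventually.of_forall hbound) hq fun B hB ε hε => ?_
    obtain ⟨N, hN⟩ := eventually_atTop.mp hB
    have hB0 : 0 ≤ B := (abs_nonneg _).trans (hN N le_rfl)
    have hpev : ∀ᶠ n in atTop, ∑' i, p n i < 2 * δ + ε / (2 * (B + 1)) :=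
      hptend.eventually_lt_const (by
        have : 0 < ε / (2 * (B + 1)) := by positivity
        linarith)
    -- For `n ≥ 2 * N`, every index of nonzero weight has `n - i ≥ N`, where the bound `B` holds.
    filter_upwards [hratio, hpev, hrem.eventually_lt_const (half_pos hε),
      eventually_ge_atTop (2 * N)] with n h1 h2 h3 h4
    have h5 : |∑ i ∈ Finset.range (n + 1), p n i * (a (n - i) / h (n - i) - L)|
        ≤ (∑' i, p n i) * B := by
      refine (Finset.abs_sum_le_sum_abs _ _).trans ?_
      rw [hpsum, Finset.sum_mul]
      refine Finset.sum_le_sum fun i _ => ?_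
      rw [abs_mul, abs_of_nonneg (hp0 n i)]
      rcases lt_or_ge n (2 * i) with hi | hi
      · simp [hp, halfWeight_eq_zero hi]
      · exact mul_le_mul_of_nonneg_left (hN _ (by omega)) (hp0 n i)
    have h6 : (∑' i, p n i) * B ≤ 2 * δ * B + ε / 2 := by
      have h7 : ε / (2 * (B + 1)) * B ≤ ε / 2 := by
        rw [div_mul_eq_mul_div, div_le_iff₀ (by positivity)]
        nlinarith
      nlinarith [mul_le_mul_of_nonneg_right h2.le hB0]
    rw [h1]
    refine (abs_sub _ _).trans ?_
    linarith
  have := tendsto_zero_iff_abs_tendsto_zero _ |>.mpr key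
  simpa using this.add_const L

/-! ### Scaled Catalan numbers: regularity, asymptotics and sum -/

theorem centralBinom_sq_mul_wallis (n : ℕ) :
    ((n.centralBinom : ℝ) / 4 ^ n) ^ 2 * ((2 * n + 1) * Real.Wallis.W n) = 1 := by
  induction n with
  | zero => simp [Real.Wallis.W]
  | succ n ih =>
    have h := Nat.succ_mul_centralBinom_succ n
    have h' : ((n + 1 : ℕ) : ℝ) * (n + 1).centralBinom = 2 * (2 * n + 1) * n.centralBinom := by
      exact_mod_cast h
    have hc : ((n + 1).centralBinom : ℝ) = 2 * (2 * n + 1) * n.centralBinom / (n + 1) := by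
      rw [eq_div_iff (by positivity), ← h']; push_cast; ring
    rw [Real.Wallis.W_succ, hc]
    refine Eq.trans ?_ ih
    push_cast
    field_simp
    ring

/-- The scaled Catalan numbers `catalan (n - 1) / 4 ^ n`, with value `0` at `0`. -/
noncomputable def scaledCatalan (n : ℕ) : ℝ := if n = 0 then 0 else catalan (n - 1) / 4 ^ n

theorem scaledCatalan_zero : scaledCatalan 0 = 0 := if_pos rfl

theorem scaledCatalan_succ (n : ℕ) : scaledCatalan (n + 1) = catalan n / 4 ^ (n + 1) := by
  simp [scaledCatalan]

theorem scaledCatalan_succ_eq_centralBinom (n : ℕ) :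
    scaledCatalan (n + 1) = (n.centralBinom : ℝ) / 4 ^ n / (4 * (n + 1)) := by
  rw [scaledCatalan_succ, ← succ_mul_catalan_eq_centralBinom]
  push_cast
  field_simp
  ring

theorem scaledCatalan_nonneg (n : ℕ) : 0 ≤ scaledCatalan n := by
  unfold scaledCatalan; split_ifs <;> positivity

theorem scaledCatalan_pos {n : ℕ} (hn : 1 ≤ n) : 0 < scaledCatalan n := by
  obtain ⟨n, rfl⟩ := Nat.exists_eq_add_of_le' hn
  rw [scaledCatalan_succ_eq_centralBinom]
  have : (0 : ℝ) < n.centralBinom := by exact_mod_cast n.centralBinom_pos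
  positivity

theorem scaledCatalan_succ_succ (n : ℕ) :
    scaledCatalan (n + 2) = scaledCatalan (n + 1) * ((2 * n + 1) / (2 * n + 4)) := by
  have h' : ((n + 1 : ℕ) : ℝ) * (n + 1).centralBinom = 2 * (2 * n + 1) * n.centralBinom := by
    exact_mod_cast Nat.succ_mul_centralBinom_succ n
  have hc : ((n + 1).centralBinom : ℝ) = 2 * (2 * n + 1) * n.centralBinom / (n + 1) := by
    rw [eq_div_iff (by positivity), ← h']; push_cast; ring
  rw [scaledCatalan_succ_eq_centralBinom, scaledCatalan_succ_eq_centralBinom, hc]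
  push_cast
  field_simp
  ring

theorem scaledCatalan_le_of_le {m n : ℕ} (hm : 1 ≤ m) (hmn : m ≤ n) :
    scaledCatalan n ≤ scaledCatalan m := by
  induction n, hmn using Nat.le_induction with
  | base => exact le_rfl
  | succ n hn ih =>
    obtain ⟨k, rfl⟩ := Nat.exists_eq_add_of_le' (hm.trans hn)
    rw [scaledCatalan_succ_succ]
    refine le_trans ?_ ih
    refine mul_le_of_le_one_right (scaledCatalan_nonneg _) ?_
    rw [div_le_one (by positivity)]
    linarith

/-- The exponent `2` exceeds the decay exponent `3 / 2`. With monotonicity of `scaledCatalan` this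
yields both bounded doubling and the limit of the shifted ratios. -/
theorem sq_mul_scaledCatalan_le_of_le {m n : ℕ} (hm : 1 ≤ m) (hmn : m ≤ n) :
    (m : ℝ) ^ 2 * scaledCatalan m ≤ (n : ℝ) ^ 2 * scaledCatalan n := by
  induction n, hmn using Nat.le_induction with
  | base => exact le_rfl
  | succ n hn ih =>
    refine ih.trans ?_
    obtain ⟨k, rfl⟩ := Nat.exists_eq_add_of_le' (hm.trans hn)
    rw [scaledCatalan_succ_succ]
    have h1 : ((k + 1 : ℕ) : ℝ) ^ 2 ≤ ((k + 1 + 1 : ℕ) : ℝ) ^ 2 * ((2 * k + 1) / (2 * k + 4)) := by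
      rw [mul_div_assoc', le_div_iff₀ (by positivity)]
      push_cast
      have : (0 : ℝ) ≤ k := k.cast_nonneg
      nlinarith [mul_nonneg this this]
    calc _ ≤ ((k + 1 + 1 : ℕ) : ℝ) ^ 2 * ((2 * k + 1) / (2 * k + 4)) * scaledCatalan (k + 1) :=
          mul_le_mul_of_nonneg_right h1 (scaledCatalan_nonneg _)
      _ = _ := by ring

theorem scaledCatalan_le_four_mul {m n : ℕ} (hm : 1 ≤ m) (hmn : m ≤ n) (hn : n ≤ 2 * m) :
    scaledCatalan m ≤ 4 * scaledCatalan n := by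
  have h1 := sq_mul_scaledCatalan_le_of_le hm hmn
  have h2 : (n : ℝ) ≤ 2 * m := by exact_mod_cast hn
  have h3 : (0 : ℝ) < (m : ℝ) ^ 2 := by positivity
  have h4 : (n : ℝ) ^ 2 ≤ (m : ℝ) ^ 2 * 4 := by nlinarith [(n.cast_nonneg : (0 : ℝ) ≤ n)]
  refine le_of_mul_le_mul_left (h1.trans ?_) h3
  calc (n : ℝ) ^ 2 * scaledCatalan n ≤ (m : ℝ) ^ 2 * 4 * scaledCatalan n :=
        mul_le_mul_of_nonneg_right h4 (scaledCatalan_nonneg _)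
    _ = _ := by ring

theorem tendsto_scaledCatalan_sub_div (i : ℕ) :
    Tendsto (fun n => scaledCatalan (n - i) / scaledCatalan n) atTop (𝓝 1) := by
  have h1 : Tendsto (fun n : ℕ => ((n : ℝ) / ((n : ℝ) - i)) ^ 2) atTop (𝓝 1) := by
    have h2 : Tendsto (fun n : ℕ => 1 + (i : ℝ) / ((n : ℝ) - i)) atTop (𝓝 (1 + 0)) :=
      ((tendsto_atTop_add_const_right _ (-(i : ℝ))
        tendsto_natCast_atTop_atTop).const_div_atTop _).const_add 1
    have h3 := h2.pow 2
    norm_num at h3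
    refine h3.congr' ?_
    filter_upwards [eventually_gt_atTop i] with n hn
    have : (n : ℝ) - i ≠ 0 := sub_ne_zero.mpr (by exact_mod_cast hn.ne')
    congr 1
    field_simp
    ring
  refine tendsto_of_tendsto_of_tendsto_of_le_of_le' tendsto_const_nhds h1 ?_ ?_
  · filter_upwards [eventually_gt_atTop i] with n hn
    rw [le_div_iff₀ (scaledCatalan_pos (by omega)), one_mul]
    exact scaledCatalan_le_of_le (by omega) (by omega)
  · filter_upwards [eventually_gt_atTop i] with n hn
    have h2 := sq_mul_scaledCatalan_le_of_le (show 1 ≤ n - i by omega) (Nat.sub_le n i)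
    rw [Nat.cast_sub hn.le] at h2
    have h3 : (0 : ℝ) < (n : ℝ) - i := sub_pos.mpr (by exact_mod_cast hn)
    rw [div_le_iff₀ (scaledCatalan_pos (by omega)), div_pow, div_mul_eq_mul_div,
      le_div_iff₀ (by positivity)]
    linarith

theorem tendsto_scaledCatalan_mul_sqrt :
    Tendsto (fun n : ℕ => scaledCatalan n * √(Real.pi * (n : ℝ) ^ 3)) atTop (𝓝 (1 / 4)) := by
  rw [← tendsto_add_atTop_iff_nat 1]
  have h1 : Tendsto (fun n : ℕ => 1 + 1 / (2 * (n : ℝ) + 1)) atTop (𝓝 (1 + 0)) :=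
    ((tendsto_atTop_add_const_right _ 1
      (tendsto_natCast_atTop_atTop.const_mul_atTop two_pos)).const_div_atTop _).const_add 1
  -- By Wallis, the square of the sequence at `n + 1` is `π / 32 * (1 + 1 / (2 * n + 1)) / W n`.
  have h2 := ((h1.const_mul (Real.pi / 32)).div Real.Wallis.tendsto_W_nhds_pi_div_two
    (by positivity)).sqrt
  have h3 : √(Real.pi / 32 * (1 + 0) / (Real.pi / 2)) = 1 / 4 := by
    rw [show Real.pi / 32 * (1 + 0) / (Real.pi / 2) = (1 / 4) ^ 2 by
      have := Real.pi_pos.ne'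
      field_simp
      norm_num]
    exact Real.sqrt_sq (by norm_num)
  rw [h3] at h2
  refine h2.congr fun n => ?_
  rw [← Real.sqrt_sq (scaledCatalan_nonneg (n + 1)), ← Real.sqrt_mul (sq_nonneg _)]
  congr 1
  have hW := Real.Wallis.W_pos n
  have hu : ((n.centralBinom : ℝ) / 4 ^ n) ^ 2 = 1 / ((2 * n + 1) * Real.Wallis.W n) := by
    rw [eq_div_iff (by positivity)]
    exact centralBinom_sq_mul_wallis n
  rw [scaledCatalan_succ_eq_centralBinom, div_pow, hu]
  simp only [Pi.div_apply]
  push_cast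
  field_simp
  ring

/-- The sum telescopes; the remainder is of order `n ^ (-1 / 2)`. -/
theorem sum_range_scaledCatalan (n : ℕ) :
    ∑ i ∈ Finset.range (n + 1), scaledCatalan i
      = 1 / 2 - 2 * (((n + 1 : ℕ) : ℝ) * scaledCatalan (n + 1)) := by
  induction n with
  | zero => simp [scaledCatalan]; norm_num
  | succ n ih =>
    rw [Finset.sum_range_succ, ih, scaledCatalan_succ_succ]
    push_cast
    field_simp
    ring

theorem tendsto_mul_scaledCatalan :
    Tendsto (fun n : ℕ => (n : ℝ) * scaledCatalan n) atTop (𝓝 0) := by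
  have h1 : Tendsto (fun n : ℕ => √(Real.pi * n)) atTop atTop :=
    Real.tendsto_sqrt_atTop.comp (tendsto_natCast_atTop_atTop.const_mul_atTop Real.pi_pos)
  refine (tendsto_scaledCatalan_mul_sqrt.div_atTop h1).congr' ?_
  filter_upwards [eventually_ge_atTop 1] with n hn
  have hn' : (0 : ℝ) < n := by exact_mod_cast hn
  have h2 : √(Real.pi * (n : ℝ) ^ 3) = n * √(Real.pi * n) := by
    rw [show Real.pi * (n : ℝ) ^ 3 = (n : ℝ) ^ 2 * (Real.pi * n) by ring,
      Real.sqrt_mul (sq_nonneg _), Real.sqrt_sq hn'.le]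
  have h3 : √(Real.pi * n) ≠ 0 := by positivity
  rw [h2]
  field_simp

theorem hasSum_scaledCatalan : HasSum scaledCatalan (1 / 2) := by
  rw [hasSum_iff_tendsto_nat_of_nonneg scaledCatalan_nonneg, ← tendsto_add_atTop_iff_nat 1]
  have h := (((tendsto_add_atTop_iff_nat 1).mpr tendsto_mul_scaledCatalan).const_mul 2).const_sub
    (1 / 2)
  rw [mul_zero, sub_zero] at h
  exact h.congr fun n => (sum_range_scaledCatalan n).symm


/-! ### True rows: total mass and asymptotics -/

theorem numTrueRows_le_numRows (n : ℕ) : numTrueRows n ≤ numRows n := by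
  have := numTrueRows_add_numFalseRows n
  omega

theorem numRows_eq_scaledCatalan (n : ℕ) : (numRows n : ℝ) = 8 ^ n * scaledCatalan n := by
  rcases n with _ | n
  · simp [numRows_zero, scaledCatalan_zero]
  · rw [numRows_succ_eq_catalan, scaledCatalan_succ, show (8 : ℝ) = 2 * 4 by norm_num, mul_pow]
    push_cast
    field_simp

/-- The scaled number of true rows `dₙ / 8 ^ n`. -/
noncomputable def scaledTrueRows (n : ℕ) : ℝ := numTrueRows n / 8 ^ n

theorem scaledTrueRows_nonneg (n : ℕ) : 0 ≤ scaledTrueRows n := by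
  unfold scaledTrueRows; positivity

theorem scaledTrueRows_le (n : ℕ) : scaledTrueRows n ≤ scaledCatalan n := by
  rw [scaledTrueRows, div_le_iff₀ (by positivity), mul_comm, ← numRows_eq_scaledCatalan]
  exact_mod_cast numTrueRows_le_numRows n

theorem summable_scaledTrueRows : Summable scaledTrueRows :=
  hasSum_scaledCatalan.summable.of_nonneg_of_le scaledTrueRows_nonneg scaledTrueRows_le

theorem scaledTrueRows_add_convolution {n : ℕ} (hn : n ≠ 1) :
    scaledTrueRows n + ∑ ij ∈ Finset.HasAntidiagonal.antidiagonal n,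
      scaledTrueRows ij.1 * scaledTrueRows ij.2 = scaledCatalan n := by
  have h1 : ∑ ij ∈ Finset.HasAntidiagonal.antidiagonal n,
      scaledTrueRows ij.1 * scaledTrueRows ij.2 = (numFalseRows n : ℝ) / 8 ^ n := by
    rw [numFalseRows_eq_sum hn]
    push_cast
    rw [Finset.sum_div]
    refine Finset.sum_congr rfl fun ij hij => ?_
    rw [Finset.HasAntidiagonal.mem_antidiagonal] at hij
    rw [scaledTrueRows, scaledTrueRows, ← hij, pow_add]
    field_simp
  rw [h1, scaledTrueRows, ← add_div, div_eq_iff (by positivity), mul_comm,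
    ← numRows_eq_scaledCatalan]
  exact_mod_cast numTrueRows_add_numFalseRows n

theorem numTrueRows_zero : numTrueRows 0 = 0 :=
  Nat.le_zero.mp ((numTrueRows_le_numRows 0).trans_eq numRows_zero)

/-- The correction comes from the single variable, which is no implication: there `h` is `1 / 4`,
`a` is `1 / 8` and the convolution vanishes. -/
theorem scaledTrueRows_convolution (n : ℕ) :
    ∑ ij ∈ Finset.HasAntidiagonal.antidiagonal n, scaledTrueRows ij.1 * scaledTrueRows ij.2
      = scaledCatalan n - scaledTrueRows n - if n = 1 then 1 / 8 else 0 := by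
  split_ifs with hn
  · subst hn
    rw [Finset.Nat.sum_antidiagonal_eq_sum_range_succ
      (fun i j => scaledTrueRows i * scaledTrueRows j)]
    simp [Finset.sum_range_succ, scaledTrueRows, numTrueRows_zero, numTrueRows_one,
      scaledCatalan]
    norm_num
  · linarith [scaledTrueRows_add_convolution hn]

/-- The Cauchy product turns the recursion into the quadratic `δ ^ 2 + δ = 3 / 8`, and `δ ≥ 0`
selects the root. -/
theorem one_add_two_mul_tsum_scaledTrueRows :
    1 + 2 * ∑' n, scaledTrueRows n = √(5 / 2) := by
  set δ := ∑' n, scaledTrueRows n with hδ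
  have hs := summable_scaledTrueRows
  have h0 : 0 ≤ δ := tsum_nonneg scaledTrueRows_nonneg
  have h1 : δ * δ = 1 / 2 - δ - 1 / 8 := by
    rw [hδ, tsum_mul_tsum_eq_tsum_sum_antidiagonal_of_summable_norm hs.norm hs.norm]
    simp only [scaledTrueRows_convolution]
    exact ((hasSum_scaledCatalan.sub hs.hasSum).sub (hasSum_ite_eq 1 (1 / 8))).tsum_eq
  rw [eq_comm, Real.sqrt_eq_iff_mul_self_eq (by norm_num) (by positivity)]
  linarith

theorem tendsto_scaledTrueRows_div :
    Tendsto (fun n => scaledTrueRows n / scaledCatalan n) atTop (𝓝 √(2 / 5)) := by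
  have h5 : √(5 / 2 : ℝ) < 2 := by
    rw [Real.sqrt_lt' (by norm_num)]; norm_num
  have h := tendsto_div_of_add_convolution_eq scaledTrueRows_nonneg scaledTrueRows_le
    (fun _ => scaledCatalan_pos) (fun _ _ => scaledCatalan_le_four_mul)
    tendsto_scaledCatalan_sub_div summable_scaledTrueRows
    (by linarith [one_add_two_mul_tsum_scaledTrueRows])
    (by
      filter_upwards [eventually_gt_atTop 1] with n hn
      exact scaledTrueRows_add_convolution hn.ne')
  rwa [one_add_two_mul_tsum_scaledTrueRows, one_div, ← Real.sqrt_inv, inv_div] at h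

theorem corollary3p6 :
    numTrueRows 0 = 0 ∧
    (∀ n : ℕ, (numTrueRows n : ℤ) = (numRows n : ℤ) - (numFalseRows n : ℤ)) ∧
    Asymptotics.IsEquivalent Filter.atTop
      (fun n : ℕ => (numTrueRows n : ℝ))
      (fun n : ℕ => Real.sqrt (2 / 5) *
        ((2 : ℝ) ^ (3 * (n : ℤ) - 2) / Real.sqrt (Real.pi * (n : ℝ) ^ 3))) := by
  refine ⟨numTrueRows_zero, fun n => ?_, ?_⟩
  · have := numTrueRows_add_numFalseRows n
    omega
  · have h5 : √(2 / 5 : ℝ) ≠ 0 := by positivity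
    refine Asymptotics.isEquivalent_of_tendsto_one ?_
    have h := (tendsto_scaledTrueRows_div.mul tendsto_scaledCatalan_mul_sqrt).const_mul
      (4 / √(2 / 5))
    rw [show 4 / √(2 / 5) * (√(2 / 5) * (1 / 4)) = 1 by field_simp] at h
    refine h.congr' ?_
    filter_upwards [eventually_ge_atTop 1] with n hn
    have hn' : (0 : ℝ) < n := by exact_mod_cast hn
    have h1 : √(Real.pi * (n : ℝ) ^ 3) ≠ 0 := by positivity
    have h2 := (scaledCatalan_pos hn).ne'
    have h3 : (2 : ℝ) ^ (3 * (n : ℤ) - 2) = 8 ^ n / 4 := by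
      rw [zpow_sub₀ two_ne_zero, zpow_mul, zpow_natCast]
      norm_num
    simp only [Pi.div_apply, scaledTrueRows]
    rw [h3]
    field_simp
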